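/- Let $p$ be a prime. A $p$-element of a profinite group $G$ is an element $g\in G$ such that the closed subgroup topologically generated by $g$ is a pro-$p$ group. Write $[a,b]=a^{-1}b^{-1}ab$, $[x,{}_0g]=x$ and $[x,{}_{n+1}g]=[[x,{}_ng],g]$. An Engel sink of $g\in G$ is a subset $\mathscr{E}\subseteq G$ such that for every $x\in G$ there is a positive integer $l=l(x,g)$ with $[x,{}_ng]\in\mathscr{E}$ for all $n\ge l$. Let $G$ be a profinite group in which every $p$-element has a finite Engel sink. Then $G$ has a closed normal subgroup $N$ such that $N$ is virtually pro-$p$ (that is, $N$ has an open subgroup that is a pro-$p$ group) and $G/N$ is a pro-$p'$ group (that is, every quotient of $G/N$ by an open normal subgroup is a finite group of order prime to $p$). -/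

import Mathlib

/-- A profinite group: a compact, Hausdorff, totally disconnected topological group. -/
structure IsProfiniteGroup (H : Type*) [Group H] [TopologicalSpace H] : Prop where
  isTopologicalGroup : IsTopologicalGroup H
  compactSpace : CompactSpace H
  t2Space : T2Space H
  totallyDisconnectedSpace : TotallyDisconnectedSpace H

/-- A pro-`p` group: a profinite group all of whose quotients by open normal subgroups
(these quotients are finite) are `p`-groups. -/
structure IsProP (p : ℕ) (H : Type*) [Group H] [TopologicalSpace H] : Prop where
  isProfiniteGroup : IsProfiniteGroup H
  isPGroup_quotient : ∀ U : Subgroup H, [U.Normal] → IsOpen (U : Set H) → IsPGroup p (H ⧸ U)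

/-- A pro-`p'` group: a profinite group all of whose quotients by open normal subgroups
(these quotients are finite) have order prime to `p`. -/
structure IsProPPrime (p : ℕ) (H : Type*) [Group H] [TopologicalSpace H] : Prop where
  isProfiniteGroup : IsProfiniteGroup H
  coprime_card_quotient : ∀ U : Subgroup H, [U.Normal] → IsOpen (U : Set H) →
    p.Coprime (Nat.card (H ⧸ U))

/-- A profinite group is virtually pro-`p` if it has an open pro-`p` subgroup. -/
structure IsVirtuallyProP (p : ℕ) (H : Type*) [Group H] [TopologicalSpace H] : Prop where
  isProfiniteGroup : IsProfiniteGroup H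
  exists_open : ∃ V : Subgroup H, IsOpen (V : Set H) ∧ IsProP p V

/-- A `p`-element of a profinite group: an element that topologically generates a pro-`p`
subgroup (its order as a supernatural number is `p ^ n` with `0 ≤ n ≤ ∞`). -/
def IsPElement (p : ℕ) {G : Type*} [Group G] [TopologicalSpace G] [IsTopologicalGroup G]
    (g : G) : Prop :=
  IsProP p (Subgroup.zpowers g).topologicalClosure

/-- The left-normed commutator `[x, g, …, g]` with `g` repeated `n` times, where
`[a, b] = a⁻¹ b⁻¹ a b`. -/
def engelCommutator {G : Type*} [Group G] (x g : G) : ℕ → G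
  | 0 => x
  | n + 1 => (engelCommutator x g n)⁻¹ * g⁻¹ * engelCommutator x g n * g

/-- `E` is a (left) Engel sink of `g`: for every `x`, all sufficiently long commutators
`[x, g, …, g]` lie in `E`. -/
def IsEngelSink {G : Type*} [Group G] (g : G) (E : Set G) : Prop :=
  ∀ x : G, ∃ l : ℕ, 0 < l ∧ ∀ n : ℕ, l ≤ n → engelCommutator x g n ∈ E

/-!
By Baer's theorem, in a finite group a `p`-element `g` all of whose iterated commutators
`[x, g, …, g]` eventually vanish lies in the `p`-core; hence if they vanish for `x` in a normal
subgroup `M`, then `[M, g]` lies in the `p`-core. A finite Engel sink meets some open normal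
subgroup at most in `1`, so applying this in all finite quotients of `G` and dividing by the largest
closed normal pro-`p` subgroup `A`, every `p`-element of `G / A` has an open centralizer.

The index of the centralizer is then lower semicontinuous on the compact set of `p`-elements, so by
Baire it has a local maximum. Near that point the centralizer is constant, whence the `p`-elements
of some open normal subgroup `D` commute with `D`. They form a normal pro-`p` subgroup, which is
trivial in `G / A`. Thus the set of `p`-elements of `G / A` is discrete, hence finite, and by
Dietzmann's lemma it generates a finite normal subgroup; `N` is the preimage of that subgroup.
-/

open scoped Topology

section EngelCommutator

variable {H K : Type*} [Group H] [Group K]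

theorem engelCommutator_add (x g : H) (m n : ℕ) :
    engelCommutator x g (m + n) = engelCommutator (engelCommutator x g m) g n := by
  induction n with
  | zero => rfl
  | succ n ih => rw [← add_assoc, engelCommutator, ih, engelCommutator]

theorem map_engelCommutator (f : H →* K) (x g : H) (n : ℕ) :
    f (engelCommutator x g n) = engelCommutator (f x) (f g) n := by
  induction n with
  | zero => rfl
  | succ n ih => simp only [engelCommutator, map_mul, map_inv, ih]

theorem engelCommutator_mem_of_normal {N : Subgroup H} [hN : N.Normal] {x : H} (hx : x ∈ N)
    (g : H) (n : ℕ) : engelCommutator x g n ∈ N := by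
  induction n with
  | zero => exact hx
  | succ n ih =>
    have := N.mul_mem (N.inv_mem ih) (hN.conj_mem _ ih g⁻¹)
    simpa only [engelCommutator, mul_assoc, inv_inv] using this

theorem engelCommutator_succ_mem_of_mem {N : Subgroup H} [hN : N.Normal] {g : H} (hg : g ∈ N)
    (x : H) (n : ℕ) : engelCommutator x g (n + 1) ∈ N := by
  have := N.mul_mem (hN.conj_mem _ (N.inv_mem hg) (engelCommutator x g n)⁻¹) hg
  rwa [inv_inv] at this

/-- `g` is a left Engel element: every `x` satisfies `[x, g, …, g] = 1` for some number of
entries `g` that may depend on `x`. -/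
def IsLeftEngel (g : H) : Prop :=
  ∀ x : H, ∃ n : ℕ, engelCommutator x g n = 1

theorem IsLeftEngel.map {g : H} (hg : IsLeftEngel g) {f : H →* K} (hf : Function.Surjective f) :
    IsLeftEngel (f g) := by
  intro y
  obtain ⟨x, rfl⟩ := hf y
  obtain ⟨n, hn⟩ := hg x
  exact ⟨n, by rw [← map_engelCommutator, hn, map_one]⟩

theorem IsLeftEngel.of_injective {g : H} {f : H →* K} (hf : Function.Injective f)
    (hg : IsLeftEngel (f g)) : IsLeftEngel g := by
  intro x
  obtain ⟨n, hn⟩ := hg (f x)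
  exact ⟨n, hf (by rw [map_engelCommutator, hn, map_one])⟩

end EngelCommutator

section PCore

variable {H : Type*} [Group H] {p : ℕ}

/-- The `p`-core `O_p(H)` of a group: the union of its normal `p`-subgroups. -/
def pCore (p : ℕ) (H : Type*) [Group H] : Subgroup H where
  carrier := {y | ∃ B : Subgroup H, B.Normal ∧ IsPGroup p B ∧ y ∈ B}
  one_mem' := ⟨⊥, inferInstance, IsPGroup.of_bot, Subgroup.one_mem _⟩
  mul_mem' := by
    rintro a b ⟨A, hA, hA', ha⟩ ⟨B, hB, hB', hb⟩
    exact ⟨A ⊔ B, inferInstance, hA'.to_sup_of_normal_right hB', Subgroup.mul_mem_sup ha hb⟩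
  inv_mem' := by
    rintro a ⟨A, hA, hA', ha⟩
    exact ⟨A, hA, hA', A.inv_mem ha⟩

theorem le_pCore {B : Subgroup H} [hB : B.Normal] (hBp : IsPGroup p B) : B ≤ pCore p H :=
  fun _ hy => ⟨B, hB, hBp, hy⟩

theorem isPGroup_pCore : IsPGroup p (pCore p H) := by
  rintro ⟨y, B, _, hB, hy⟩
  obtain ⟨k, hk⟩ := hB ⟨y, hy⟩
  exact ⟨k, Subtype.ext (by simpa using congrArg Subtype.val hk)⟩

instance pCore_characteristic : (pCore p H).Characteristic := by
  rw [Subgroup.characteristic_iff_map_le]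
  rintro φ _ ⟨y, ⟨B, hB, hB', hy⟩, rfl⟩
  exact ⟨B.map φ.toMonoidHom, hB.map _ φ.surjective, hB'.map _, Subgroup.mem_map_of_mem _ hy⟩

theorem map_subtype_pCore_le (M : Subgroup H) [M.Normal] :
    (pCore p M).map M.subtype ≤ pCore p H :=
  le_pCore (isPGroup_pCore.map _)

theorem mem_pCore_of_mem_pCore_of_le {K M : Subgroup H} [M.Normal] (hMK : M ≤ K) {x : H}
    (hxM : x ∈ M) (hxK : x ∈ (pCore p K).map K.subtype) : x ∈ pCore p H := by
  set C := (pCore p K).map K.subtype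
  have hKC : K ≤ Subgroup.normalizer (C : Set H) := by
    have := Subgroup.le_normalizer_map (H := pCore p K) K.subtype
    rwa [Subgroup.normalizer_eq_top, ← MonoidHom.range_eq_map, K.range_subtype] at this
  have : (C.subgroupOf M).Normal :=
    Subgroup.normal_subgroupOf_of_le_normalizer (hMK.trans hKC)
  have hCM : C.subgroupOf M ≤ pCore p M := le_pCore (isPGroup_pCore.map K.subtype).comap_subtype
  exact map_subtype_pCore_le M ⟨⟨x, hxM⟩, hCM hxK, rfl⟩

end PCore

section Baer

variable {H : Type*} [Group H] [Finite H] {p : ℕ} [Fact p.Prime] {T : Set H}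

theorem exists_mem_normalizer_inter (hT : ∀ t ∈ T, ∀ x : H, x * t * x⁻¹ ∈ T)
    {P K : Subgroup H} (hP : IsPGroup p P) (hKP : K ≤ P) (hPK : ¬ (P : Set H) ∩ T ⊆ K) :
    ∃ t ∈ T, t ∈ P ∧ t ∉ K ∧ t ∈ Subgroup.normalizer ((K : Set H) ∩ T) := by
  obtain ⟨L, ⟨hKL, hLP, hLT⟩, hLmax⟩ := (Set.toFinite
    {L : Subgroup H | K ≤ L ∧ L ≤ P ∧ (L : Set H) ∩ T = (K : Set H) ∩ T}).exists_maximal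
    ⟨K, le_rfl, hKP, rfl⟩
  set N := Subgroup.normalizer (L : Set H) ⊓ P
  have hLN : L < N := by
    have : Group.IsNilpotent P := hP.isNilpotent
    have hLtop : L.subgroupOf P ≠ ⊤ := fun h =>
      hPK fun y hy => (hLT.le ⟨Subgroup.subgroupOf_eq_top.1 h hy.1, hy.2⟩).1
    have hlt := Group.normalizerCondition_of_isNilpotent _ hLtop.lt_top
    rw [← Subgroup.subgroupOf_normalizer_eq hLP] at hlt
    obtain ⟨x, hxN, hxL⟩ := Set.exists_of_ssubset hlt
    exact lt_of_le_of_ne (le_inf Subgroup.le_normalizer hLP)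
      fun h => hxL (h.ge ⟨hxN, x.2⟩ : (x : H) ∈ L)
  obtain ⟨t, ⟨htN, htT⟩, htK⟩ : ∃ t ∈ (N : Set H) ∩ T, t ∉ K := by
    by_contra! h
    exact hLN.not_ge (hLmax ⟨hKL.trans hLN.le, inf_le_right,
      Set.Subset.antisymm (fun y hy => ⟨h y hy, hy.2⟩)
        (Set.inter_subset_inter_left _ (hKL.trans hLN.le))⟩ hLN.le)
  refine ⟨t, htT, htN.2, htK, ?_⟩
  rw [← hLT]
  exact Subgroup.mem_normalizer_fintype fun n hn => ⟨(htN.1 n).1 hn.1, hT n hn.2 t⟩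

theorem le_normalizer_inter (hT : ∀ t ∈ T, ∀ x : H, x * t * x⁻¹ ∈ T) (K : Subgroup H) :
    K ≤ Subgroup.normalizer ((K : Set H) ∩ T) := fun x hx =>
  Subgroup.mem_normalizer_fintype fun t ht =>
    ⟨K.mul_mem (K.mul_mem hx ht.1) (K.inv_mem hx), hT t ht.2 x⟩

omit [Fact p.Prime] in
theorem exists_isCoatom_normalizer_le {S : Set H} (hne : S.Nonempty)
    (hSp : IsPGroup p (Subgroup.closure S)) (hS : ∀ s ∈ S, s ∉ pCore p H) :
    ∃ L : Subgroup H, IsCoatom L ∧ Subgroup.normalizer S ≤ L := by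
  refine (eq_top_or_exists_le_coatom (Subgroup.normalizer S)).resolve_left fun htop => ?_
  have : (Subgroup.closure S).Normal := Subgroup.normalizer_eq_top_iff.1
    (top_le_iff.1 (htop.ge.trans (Subgroup.normalizer_le_normalizer_closure S)))
  obtain ⟨s, hs⟩ := hne
  exact hS s hs (le_pCore hSp (Subgroup.subset_closure hs))

theorem eq_of_normalizer_inter_le (hT : ∀ t ∈ T, ∀ x : H, x * t * x⁻¹ ∈ T)
    {K M L : Subgroup H} (hK : IsCoatom K) (hL : IsCoatom L)
    (hKp : (K : Set H) ∩ T ⊆ (pCore p K).map K.subtype)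
    (hmax : K ≠ L → ((K ⊓ L : Subgroup H) ∩ T : Set H).ncard ≤
      ((K ⊓ M : Subgroup H) ∩ T : Set H).ncard)
    (hML : Subgroup.normalizer ((K ⊓ M : Subgroup H) ∩ T : Set H) ≤ L) : K = L := by
  set P := (pCore p K).map K.subtype
  have hPK : P ≤ K := Subgroup.map_subtype_le _
  have hPM : ((P ⊓ M : Subgroup H) : Set H) ∩ T = ((K ⊓ M : Subgroup H) : Set H) ∩ T :=
    Set.Subset.antisymm (fun t ht => ⟨⟨hPK ht.1.1, ht.1.2⟩, ht.2⟩)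
      fun t ht => ⟨⟨hKp ⟨ht.1.1, ht.2⟩, ht.1.2⟩, ht.2⟩
  by_contra hKL
  by_cases hPT : (P : Set H) ∩ T ⊆ (P ⊓ M : Subgroup H)
  · have hKT : ((K ⊓ M : Subgroup H) : Set H) ∩ T = (K : Set H) ∩ T :=
      Set.Subset.antisymm (fun t ht => ⟨ht.1.1, ht.2⟩)
        fun t ht => ⟨⟨ht.1, (hPT ⟨hKp ht, ht.2⟩).2⟩, ht.2⟩
    rw [hKT] at hML
    exact hKL ((hK.le_iff.1 ((le_normalizer_inter hT K).trans hML)).resolve_left hL.1).symm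
  · obtain ⟨t, htT, htP, htM, htN⟩ :=
      exists_mem_normalizer_inter hT (isPGroup_pCore.map K.subtype) inf_le_left hPT
    rw [hPM] at htN
    refine (hmax hKL).not_gt (Set.ncard_lt_ncard (Set.ssubset_iff_exists.2 ⟨fun s hs => ?_, ?_⟩))
    · exact ⟨⟨hs.1.1, hML (le_normalizer_inter hT _ hs.1)⟩, hs.2⟩
    · exact ⟨t, ⟨⟨hPK htP, hML htN⟩, htT⟩, fun ht => htM ⟨htP, ht.1.2⟩⟩

theorem eq_of_isCoatom_of_mem_inter (hT : ∀ t ∈ T, ∀ x : H, x * t * x⁻¹ ∈ T)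
    (hTp : ∀ K : Subgroup H, K ≠ ⊤ → (K : Set H) ∩ T ⊆ (pCore p K).map K.subtype)
    (hTH : ∀ t ∈ T, t ∉ pCore p H) {K M : Subgroup H} (hK : IsCoatom K) (hM : IsCoatom M)
    {t : H} (ht : t ∈ T) (htK : t ∈ K) (htM : t ∈ M) : K = M := by
  -- Choose maximal `K' ≠ M'` with `K' ∩ M' ∩ T` largest: a maximal subgroup containing the
  -- normalizer of this set has to equal both.
  by_contra hKM
  let size (K M : Subgroup H) : ℕ := ((K ⊓ M : Subgroup H) ∩ T : Set H).ncard
  have hpos : 0 < size K M := (Set.ncard_pos).2 ⟨t, ⟨htK, htM⟩, ht⟩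
  obtain ⟨⟨K', M'⟩, ⟨hK', hM', hne⟩, hmax⟩ := Set.exists_max_image
    {q : Subgroup H × Subgroup H | IsCoatom q.1 ∧ IsCoatom q.2 ∧ q.1 ≠ q.2}
    (fun q => size q.1 q.2) (Set.toFinite _) ⟨(K, M), hK, hM, hKM⟩
  have hmax' (K L : Subgroup H) (hK : IsCoatom K) (hL : IsCoatom L) (h : K ≠ L) :
      size K L ≤ size K' M' := hmax (K, L) ⟨hK, hL, h⟩
  have hp : IsPGroup p (Subgroup.closure ((K' ⊓ M' : Subgroup H) ∩ T : Set H)) :=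
    (isPGroup_pCore.map K'.subtype).to_le ((Subgroup.closure_le _).2 fun s hs =>
      hTp K' hK'.1 ⟨hs.1.1, hs.2⟩)
  obtain ⟨L, hL, hNL⟩ := exists_isCoatom_normalizer_le
    ((Set.ncard_pos).1 (hpos.trans_le (hmax' K M hK hM hKM))) hp fun s hs => hTH s hs.2
  have hKL : K' = L := eq_of_normalizer_inter_le hT hK' hL (hTp K' hK'.1) (hmax' _ _ hK' hL) hNL
  have hML : M' = L := eq_of_normalizer_inter_le (M := K') hT hM' hL (hTp M' hM'.1)
    (fun h => inf_comm K' M' ▸ hmax' _ _ hM' hL h) (by rwa [inf_comm])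
  exact hne (hKL.trans hML.symm)

omit [Finite H] in
theorem mem_of_engelCommutator_mem {M : Subgroup H} {g : H}
    (hM : ∀ y : H, engelCommutator y g 1 ∈ M → y ∈ M) {x : H} {n : ℕ}
    (hx : engelCommutator x g n ∈ M) : x ∈ M := by
  induction n with
  | zero => exact hx
  | succ n ih => exact ih (hM _ (by rwa [← engelCommutator_add]))

theorem exists_isCoatom_mem {g : H} (hg : ∃ k : ℕ, g ^ p ^ k = 1) (hgH : g ∉ pCore p H) :
    ∃ M : Subgroup H, IsCoatom M ∧ g ∈ M := by
  obtain h | ⟨M, hM, h⟩ := eq_top_or_exists_le_coatom (Subgroup.zpowers g)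
  · obtain ⟨k, hk⟩ := hg
    obtain ⟨m, -, hm⟩ := (Nat.dvd_prime_pow Fact.out).1 (orderOf_dvd_of_pow_eq_one hk)
    have : (Subgroup.zpowers g).Normal := h ▸ inferInstance
    exact absurd (le_pCore (IsPGroup.of_card (Nat.card_zpowers g ▸ hm))
      (Subgroup.mem_zpowers g)) hgH
  · exact ⟨M, hM, h (Subgroup.mem_zpowers g)⟩

theorem mem_pCore_of_isLeftEngel {g : H} (hg : ∃ k : ℕ, g ^ p ^ k = 1) (hE : IsLeftEngel g) :
    g ∈ pCore p H := by
  induction hn : Nat.card H using Nat.strong_induction_on generalizing H with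
  | _ n ih =>
  subst hn
  by_contra hgH
  let T : Set H := {t | (∃ k : ℕ, t ^ p ^ k = 1) ∧ IsLeftEngel t ∧ t ∉ pCore p H}
  have hgT : g ∈ T := ⟨hg, hE, hgH⟩
  have hT : ∀ t ∈ T, ∀ x : H, x * t * x⁻¹ ∈ T := by
    rintro t ⟨⟨k, hk⟩, htE, htH⟩ x
    refine ⟨⟨k, by rw [conj_pow, hk, mul_one, mul_inv_cancel]⟩,
      htE.map (f := (MulAut.conj x).toMonoidHom) (MulAut.conj x).surjective, fun h => htH ?_⟩
    simpa [mul_assoc] using (pCore p H).normal_of_characteristic.conj_mem _ h x⁻¹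
  have hTp (K : Subgroup H) (hK : K ≠ ⊤) : (K : Set H) ∩ T ⊆ (pCore p K).map K.subtype := by
    rintro t ⟨htK, ⟨k, hk⟩, htE, -⟩
    refine ⟨⟨t, htK⟩, ih _ ?_ ⟨k, Subtype.ext hk⟩ (htE.of_injective K.subtype_injective) rfl, rfl⟩
    exact (Subgroup.card_le_card_group K).lt_of_ne fun h => hK (Subgroup.eq_top_of_card_eq K h)
  obtain ⟨M, hM, hgM⟩ := exists_isCoatom_mem hg hgH
  have hMN (y : H) (hy : engelCommutator y g 1 ∈ M) : y ∈ Subgroup.normalizer (M : Set H) := by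
    have hgy : y⁻¹ * g * y ∈ M := by
      simpa [engelCommutator, mul_assoc] using M.inv_mem (M.mul_mem hy (M.inv_mem hgM))
    rw [Subgroup.mem_normalizer_iff_map_conj_eq]
    exact eq_of_isCoatom_of_mem_inter hT hTp (fun t ht => ht.2.2)
      (((MulAut.conj y).mapSubgroup.isCoatom_iff M).2 hM) hM hgT
      ⟨_, hgy, by simp [mul_assoc]⟩ hgM
  obtain hN | hN := hM.le_iff.1 (Subgroup.le_normalizer (H := M))
  · have : M.Normal := Subgroup.normalizer_eq_top_iff.1 hN
    exact hgH (map_subtype_pCore_le M (hTp M hM.1 ⟨hgM, hgT⟩))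
  · rw [hN] at hMN
    refine hM.1 ((Subgroup.eq_top_iff' M).2 fun x => ?_)
    obtain ⟨n, hn⟩ := hE x
    exact mem_of_engelCommutator_mem hMN (hn ▸ M.one_mem)

theorem engelCommutator_one_mem_pCore {M : Subgroup H} [M.Normal] {g : H}
    (hg : ∃ k : ℕ, g ^ p ^ k = 1) (hE : ∀ x ∈ M, ∃ n : ℕ, engelCommutator x g n = 1)
    {x : H} (hx : x ∈ M) : engelCommutator x g 1 ∈ pCore p H := by
  let K : Subgroup H :=
    (Subgroup.centralizer {QuotientGroup.mk' M g}).comap (QuotientGroup.mk' M)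
  have hK (y : H) : y ∈ K ↔ engelCommutator y g 1 ∈ M := by
    rw [Subgroup.mem_comap, Subgroup.mem_centralizer_singleton_iff, ← map_mul, ← map_mul,
      eq_comm, QuotientGroup.mk'_apply, QuotientGroup.mk'_apply, QuotientGroup.eq]
    simp [engelCommutator, mul_assoc]
  have hgK : g ∈ K := (hK g).2 (by simp [engelCommutator])
  have hMK : M ≤ K := fun y hy => (hK y).2 (engelCommutator_mem_of_normal hy g 1)
  have hgE : IsLeftEngel (⟨g, hgK⟩ : K) := fun y => by
    obtain ⟨n, hn⟩ := hE _ ((hK y).1 y.2)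
    refine ⟨1 + n, K.subtype_injective ?_⟩
    rw [map_engelCommutator, engelCommutator_add]
    exact hn
  obtain ⟨k, hk⟩ := hg
  have hgp : (⟨g, hgK⟩ : K) ∈ pCore p K := mem_pCore_of_isLeftEngel ⟨k, Subtype.ext hk⟩ hgE
  refine mem_pCore_of_mem_pCore_of_le hMK (engelCommutator_mem_of_normal hx g 1)
    ⟨engelCommutator ⟨x, hMK hx⟩ ⟨g, hgK⟩ 1, ?_, map_engelCommutator K.subtype _ _ 1⟩
  exact engelCommutator_succ_mem_of_mem hgp _ 0

end Baer

section FiniteIndexCentralizer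

variable {H : Type*} [Group H]

open scoped IsMulCommutative in
theorem finite_of_closure_eq_top {X : Set H} (hX : X.Finite) (htop : Subgroup.closure X = ⊤)
    (hfin : ∀ x ∈ X, IsOfFinOrder x) (hC : ∀ x ∈ X, (Subgroup.centralizer {x}).FiniteIndex) :
    Finite H := by
  have := hX.to_subtype
  have hZ : (Subgroup.center H).FiniteIndex := by
    rw [Subgroup.center_eq_infi' htop]
    exact Subgroup.finiteIndex_iInf fun x => hC x x.2
  have htorsion (y : H) : IsOfFinOrder y := by
    have : IsOfFinOrder (MonoidHom.transferCenterPow H y) := by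
      induction htop.ge (Subgroup.mem_top y) using Subgroup.closure_induction with
      | mem x hx => exact MonoidHom.isOfFinOrder _ (hfin x hx)
      | one => rw [map_one]; exact IsOfFinOrder.one
      | mul a b _ _ ha hb => rw [map_mul]; exact ha.mul hb
      | inv a _ ha => rw [map_inv]; exact ha.inv
    exact ((Subgroup.center H).subtype.isOfFinOrder this).of_pow hZ.index_ne_zero
  have : Group.FG H := Group.fg_iff.2 ⟨X, htop, hX⟩
  have : Finite (Subgroup.center H) := CommGroup.finite_of_fg_isMulTorsion _ fun z =>
    Submonoid.isOfFinOrder_coe.1 (htorsion z)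
  exact Finite.of_subgroup_quotient (Subgroup.center H)

theorem finite_closure {X : Set H} (hX : X.Finite)
    (hfin : ∀ x ∈ X, IsOfFinOrder x) (hC : ∀ x ∈ X, (Subgroup.centralizer {x}).FiniteIndex) :
    Finite (Subgroup.closure X) := by
  refine finite_of_closure_eq_top (X := ((↑) : Subgroup.closure X → H) ⁻¹' X)
    (hX.preimage Subtype.val_injective.injOn) (Subgroup.closure_closure_coe_preimage)
    (fun x hx => Submonoid.isOfFinOrder_coe.1 (hfin x hx)) fun x hx => ?_
  have := hC x hx
  refine Subgroup.finiteIndex_of_le (H := (Subgroup.centralizer {(x : H)}).subgroupOf _) ?_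
  intro y hy
  rw [Subgroup.mem_subgroupOf, Subgroup.mem_centralizer_singleton_iff] at hy
  exact Subgroup.mem_centralizer_singleton_iff.2 (Subtype.ext hy)

theorem mk_centralizer_eq_mk_iff {x y v : H} :
    (x : H ⧸ Subgroup.centralizer {v}) = y ↔ x * v * x⁻¹ = y * v * y⁻¹ := by
  rw [QuotientGroup.eq, Subgroup.mem_centralizer_singleton_iff]
  constructor <;> intro h
  · calc x * v * x⁻¹ = x * (v * (x⁻¹ * y)) * y⁻¹ := by group
      _ = y * v * y⁻¹ := by rw [← h]; group
  · calc x⁻¹ * y * v = x⁻¹ * (y * v * y⁻¹) * y := by group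
      _ = v * (x⁻¹ * y) := by rw [← h]; group

theorem exists_isLocalMax_of_lowerSemicontinuous {X : Type*} [TopologicalSpace X] [BaireSpace X]
    [Nonempty X] {f : X → ℕ} (hf : LowerSemicontinuous f) : ∃ x, IsLocalMax f x := by
  obtain ⟨n, hn⟩ := nonempty_interior_of_iUnion_of_closed
    (fun n : ℕ => hf.isClosed_preimage n) (Set.iUnion_eq_univ_iff.2 fun x => ⟨f x, le_refl (f x)⟩)
  have hbdd : BddAbove (f '' interior (f ⁻¹' Set.Iic n)) :=
    ⟨n, Set.forall_mem_image.2 fun x hx => (interior_subset hx : x ∈ f ⁻¹' Set.Iic n)⟩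
  obtain ⟨x, hx, hfx⟩ := Nat.sSup_mem (hn.image f) hbdd
  refine ⟨x, Filter.mem_of_superset (isOpen_interior.mem_nhds hx) fun y hy => ?_⟩
  exact (le_csSup hbdd (Set.mem_image_of_mem f hy)).trans_eq hfx.symm

theorem lowerSemicontinuous_index_centralizer [TopologicalSpace H] [IsTopologicalGroup H]
    [T2Space H] {S : Set H} (hS : ∀ u ∈ S, (Subgroup.centralizer {u}).FiniteIndex) :
    LowerSemicontinuous fun u : S => (Subgroup.centralizer {(u : H)}).index := by
  intro u n hn
  have := hS u u.2
  let r (c : H ⧸ Subgroup.centralizer {(u : H)}) (v : H) : H := c.out * v * c.out⁻¹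
  have hr : ∀ᶠ v : S in 𝓝 u, ∀ c d, c ≠ d → r c v ≠ r d v := by
    refine Filter.eventually_all.2 fun c => Filter.eventually_all.2 fun d =>
      Filter.eventually_imp_distrib_left.2 fun hcd => ?_
    have hcont (c) : Continuous fun v : S => r c v := by fun_prop
    refine (isOpen_ne_fun (hcont c) (hcont d)).mem_nhds fun h => hcd ?_
    simpa using mk_centralizer_eq_mk_iff.2 h
  filter_upwards [hr] with v hv
  have := hS v v.2
  refine hn.trans_le (Nat.card_le_card_of_injective
    (fun c : H ⧸ Subgroup.centralizer {(u : H)} => (c.out : H ⧸ Subgroup.centralizer {(v : H)}))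
    fun c d h => ?_)
  by_contra hcd
  exact hv c d hcd (mk_centralizer_eq_mk_iff.1 h)

end FiniteIndexCentralizer

section PElement

variable {G : Type*} [Group G] [TopologicalSpace G] [IsTopologicalGroup G] {p : ℕ}

theorem isClosed_setOf_exists_pow_mem (N : OpenNormalSubgroup G) :
    IsClosed {g : G | ∃ k : ℕ, g ^ p ^ k ∈ N} := by
  have : {g : G | ∃ k : ℕ, g ^ p ^ k ∈ N} =
      (QuotientGroup.mk : G → G ⧸ N.toSubgroup) ⁻¹' {x | ∃ k : ℕ, x ^ p ^ k = 1} := by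
    ext g
    simp only [Set.mem_preimage, Set.mem_ofPred_eq, ← QuotientGroup.mk_pow,
      QuotientGroup.eq_one_iff]
    rfl
  rw [this]
  exact (isClosed_discrete _).preimage QuotientGroup.continuous_mk

variable [CompactSpace G] [TotallyDisconnectedSpace G]

theorem exists_openNormalSubgroup_subgroupOf_le {B : Subgroup G} {U : Subgroup B}
    (hU : IsOpen (U : Set B)) : ∃ N : OpenNormalSubgroup G, N.toSubgroup.subgroupOf B ≤ U := by
  obtain ⟨V, hV, hVU⟩ := isOpen_induced_iff.1 hU
  have h1 : (1 : B) ∈ Subtype.val ⁻¹' V := hVU ▸ U.one_mem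
  obtain ⟨N, hN⟩ := ProfiniteGrp.exist_openNormalSubgroup_sub_open_nhds_of_one hV h1
  exact ⟨N, fun b hb => hVU.le (hN hb)⟩

theorem isProP_iff {B : Subgroup G} (hB : IsClosed (B : Set G)) :
    IsProP p B ↔ ∀ b ∈ B, ∀ N : OpenNormalSubgroup G, ∃ k : ℕ, b ^ p ^ k ∈ N := by
  constructor
  · intro h b hb N
    obtain ⟨k, hk⟩ := h.isPGroup_quotient (N.toSubgroup.subgroupOf B)
      (N.isOpen.preimage continuous_subtype_val) (⟨b, hb⟩ : B)
    rw [← QuotientGroup.mk_pow, QuotientGroup.eq_one_iff] at hk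
    exact ⟨k, hk⟩
  · intro h
    refine ⟨⟨inferInstance, isCompact_iff_compactSpace.1 hB.isCompact, inferInstance,
      inferInstance⟩, fun U _ hU => QuotientGroup.mk_surjective.forall.2 fun b => ?_⟩
    obtain ⟨N, hN⟩ := exists_openNormalSubgroup_subgroupOf_le hU
    exact (h b b.2 N).imp fun k hk => (QuotientGroup.eq_one_iff _).2 (hN hk)

theorem isPElement_iff {g : G} :
    IsPElement p g ↔ ∀ N : OpenNormalSubgroup G, ∃ k : ℕ, g ^ p ^ k ∈ N := by
  refine (isProP_iff (Subgroup.isClosed_topologicalClosure _)).trans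
    ⟨fun h => h g (Subgroup.le_topologicalClosure _ (Subgroup.mem_zpowers g)),
      fun h b hb N => ?_⟩
  refine closure_minimal ?_ (isClosed_setOf_exists_pow_mem N) hb
  rintro _ ⟨n, rfl⟩
  refine (h N).imp fun k hk => ?_
  have hcomm : (g ^ n) ^ p ^ k = (g ^ p ^ k) ^ n := by
    rw [← zpow_natCast, ← zpow_mul, mul_comm, zpow_mul, zpow_natCast]
  exact hcomm ▸ N.toSubgroup.zpow_mem hk n

theorem isClosed_setOf_isPElement : IsClosed {g : G | IsPElement p g} := by
  simp only [isPElement_iff, Set.ofPred_forall]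
  exact isClosed_iInter isClosed_setOf_exists_pow_mem

theorem isPElement_one : IsPElement p (1 : G) :=
  isPElement_iff.2 fun N => ⟨0, by rw [one_pow]; exact N.toSubgroup.one_mem⟩

theorem IsPElement.inv {g : G} (hg : IsPElement p g) : IsPElement p g⁻¹ :=
  isPElement_iff.2 fun N => (isPElement_iff.1 hg N).imp fun k hk => by
    rw [inv_pow]; exact N.toSubgroup.inv_mem hk

theorem IsPElement.pow {g : G} (hg : IsPElement p g) (n : ℕ) : IsPElement p (g ^ n) :=
  isPElement_iff.2 fun N => (isPElement_iff.1 hg N).imp fun k hk => by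
    rw [pow_right_comm]; exact N.toSubgroup.pow_mem hk n

theorem IsPElement.conj {g : G} (hg : IsPElement p g) (x : G) : IsPElement p (x * g * x⁻¹) :=
  isPElement_iff.2 fun N => (isPElement_iff.1 hg N).imp fun k hk => by
    rw [conj_pow]; exact N.isNormal'.conj_mem _ hk x

instance normal_closure_setOf_isPElement :
    (Subgroup.closure {g : G | IsPElement p g}).Normal := by
  rw [← Subgroup.normalizer_eq_top_iff, eq_top_iff, Subgroup.le_normalizer_closure_iff]
  exact fun x _ g hg => Subgroup.subset_closure (IsPElement.conj hg x)

theorem IsPElement.mul {g h : G} (hg : IsPElement p g) (hh : IsPElement p h)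
    (hgh : Commute g h) : IsPElement p (g * h) := by
  refine isPElement_iff.2 fun N => ?_
  obtain ⟨k, hk⟩ := isPElement_iff.1 hg N
  obtain ⟨l, hl⟩ := isPElement_iff.1 hh N
  refine ⟨k + l, ?_⟩
  rw [hgh.mul_pow, pow_add, pow_mul, mul_comm (p ^ k), pow_mul h]
  exact N.toSubgroup.mul_mem (N.toSubgroup.pow_mem hk _) (N.toSubgroup.pow_mem hl _)

theorem IsPElement.map {K : Type*} [Group K] [TopologicalSpace K] [IsTopologicalGroup K]
    [CompactSpace K] [TotallyDisconnectedSpace K] {g : G} (hg : IsPElement p g)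
    {f : G →* K} (hf : Continuous f) : IsPElement p (f g) := by
  refine isPElement_iff.2 fun N => ?_
  obtain ⟨k, hk⟩ := isPElement_iff.1 hg ⟨N.toOpenSubgroup.comap f hf, N.isNormal'.comap f⟩
  exact ⟨k, by rw [← map_pow]; exact hk⟩

omit [TotallyDisconnectedSpace G] in
/-- The Chinese remainder theorem makes a suitable power of `d` both congruent to `d` modulo `K`
and a `p`-element modulo `N`. -/
theorem exists_inv_mul_pow_mem (hp : p.Prime) {K N : OpenNormalSubgroup G} {d : G} {k : ℕ}
    (hd : d ^ p ^ k ∈ K) : ∃ e : ℕ, d⁻¹ * d ^ e ∈ K ∧ ∃ l : ℕ, (d ^ e) ^ p ^ l ∈ N := by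
  obtain ⟨a, b, hb, hcard⟩ := Nat.exists_eq_pow_mul_and_not_dvd
    (Nat.card_pos (α := G ⧸ N.toSubgroup)).ne' p hp.ne_one
  obtain ⟨e, heK, heb⟩ := Nat.chineseRemainder
    (((Nat.Prime.coprime_iff_not_dvd hp).2 hb).pow_left k) 1 0
  refine ⟨e, ?_, a, ?_⟩
  · have hdK : (d : G ⧸ K.toSubgroup) ^ p ^ k = 1 := (QuotientGroup.eq_one_iff _).2 hd
    have hde := pow_eq_pow_iff_modEq.2 (heK.of_dvd (orderOf_dvd_of_pow_eq_one hdK))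
    rw [pow_one] at hde
    exact QuotientGroup.eq.1 hde.symm
  · obtain ⟨c, rfl⟩ := Nat.modEq_zero_iff_dvd.1 heb
    refine (QuotientGroup.eq_one_iff (N := N.toSubgroup) _).1 ?_
    rw [← pow_mul, mul_right_comm, mul_comm b, ← hcard, QuotientGroup.mk_pow, pow_mul,
      pow_card_eq_one', one_pow]

theorem exists_isPElement_inv_mul_mem (hp : p.Prime) {K : OpenNormalSubgroup G} {d : G} {k : ℕ}
    (hd : d ^ p ^ k ∈ K) : ∃ g : G, IsPElement p g ∧ d⁻¹ * g ∈ K := by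
  let S (N : OpenNormalSubgroup G) : Set G := {g | d⁻¹ * g ∈ K ∧ ∃ l : ℕ, g ^ p ^ l ∈ N}
  have hS (N) : IsClosed (S N) :=
    (K.toOpenSubgroup.isClosed.preimage (continuous_const_mul d⁻¹)).inter
      (isClosed_setOf_exists_pow_mem N)
  have : Nonempty (OpenNormalSubgroup G) := ⟨K⟩
  obtain ⟨g, hg⟩ := IsCompact.nonempty_iInter_of_directed_nonempty_isCompact_isClosed S
    (fun N N' => ⟨N ⊓ N', fun g hg => ⟨hg.1, hg.2.imp fun _ h => h.1⟩,
      fun g hg => ⟨hg.1, hg.2.imp fun _ h => h.2⟩⟩)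
    (fun N => (exists_inv_mul_pow_mem hp hd).elim fun e he => ⟨d ^ e, he⟩)
    (fun N => (hS N).isCompact) hS
  rw [Set.mem_iInter] at hg
  exact ⟨g, isPElement_iff.2 fun N => (hg N).2, (hg K).1⟩

instance totallyDisconnectedSpace_quotient (A : Subgroup G) [A.Normal]
    [IsClosed (A : Set G)] : TotallyDisconnectedSpace (G ⧸ A) := by
  have : NonarchimedeanGroup (G ⧸ A) := by
    refine ⟨fun U hU => ?_⟩
    obtain ⟨V, hVU, hV, h1⟩ := mem_nhds_iff.1 hU
    obtain ⟨N, hN⟩ := ProfiniteGrp.exist_openNormalSubgroup_sub_open_nhds_of_one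
      (hV.preimage (QuotientGroup.continuous_mk (N := A))) h1
    refine ⟨⟨N.toSubgroup.map (QuotientGroup.mk' A), QuotientGroup.isOpenMap_coe _ N.isOpen⟩, ?_⟩
    rintro _ ⟨x, hx, rfl⟩
    exact hVU (hN hx)
  infer_instance

theorem isProPPrime_quotient (hp : p.Prime) {N : Subgroup G} [N.Normal] (hN : IsClosed (N : Set G))
    (h : ∀ g, IsPElement p g → g ∈ N) : IsProPPrime p (G ⧸ N) := by
  refine ⟨⟨inferInstance, inferInstance, inferInstance, inferInstance⟩, fun U _ hU => ?_⟩
  have : Fact p.Prime := ⟨hp⟩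
  have : Finite ((G ⧸ N) ⧸ U) := U.quotient_finite_of_isOpen hU
  rw [Nat.Prime.coprime_iff_not_dvd hp]
  intro hdvd
  obtain ⟨y, hy⟩ := exists_prime_orderOf_dvd_card' p hdvd
  obtain ⟨x, rfl⟩ := QuotientGroup.mk_surjective y
  obtain ⟨d, rfl⟩ := QuotientGroup.mk_surjective x
  let f : G →* (G ⧸ N) ⧸ U := (QuotientGroup.mk' U).comp (QuotientGroup.mk' N)
  have : DiscreteTopology ((G ⧸ N) ⧸ U) := QuotientGroup.discreteTopology hU
  let K : OpenNormalSubgroup G := ⟨⟨f.ker, (isOpen_discrete {1}).preimage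
    (QuotientGroup.continuous_mk.comp QuotientGroup.continuous_mk)⟩, f.normal_ker⟩
  have hfd : orderOf (f d) = p := hy
  have hdK : d ^ p ^ 1 ∈ K := by
    change f (d ^ p ^ 1) = 1
    rw [pow_one, map_pow, orderOf_dvd_iff_pow_eq_one.1 hfd.dvd]
  obtain ⟨g, hg, hdg⟩ := exists_isPElement_inv_mul_mem hp hdK
  have hNf : N ≤ f.ker := fun n hn =>
    (congrArg (QuotientGroup.mk' U) ((QuotientGroup.eq_one_iff n).2 hn)).trans (map_one _)
  have hfg : f g = 1 := hNf (h g hg)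
  have hfdg : (f d)⁻¹ * f g = 1 := by rw [← map_inv, ← map_mul]; exact hdg
  rw [hfg, mul_one, inv_eq_one] at hfdg
  exact hp.ne_one (by rw [← hfd, hfdg, orderOf_one])

end PElement

section ProfinitePCore

variable {G : Type*} [Group G] [TopologicalSpace G] [IsTopologicalGroup G] {p : ℕ}

/-- The largest closed normal pro-`p` subgroup of a profinite group, as the elements that lie in
the `p`-core modulo every open normal subgroup. -/
def profinitePCore (p : ℕ) (G : Type*) [Group G] [TopologicalSpace G] : Subgroup G :=
  ⨅ N : OpenNormalSubgroup G,
    (pCore p (G ⧸ N.toSubgroup)).comap (QuotientGroup.mk' N.toSubgroup)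

omit [IsTopologicalGroup G] in
theorem mem_profinitePCore {x : G} :
    x ∈ profinitePCore p G ↔
      ∀ N : OpenNormalSubgroup G, (x : G ⧸ N.toSubgroup) ∈ pCore p (G ⧸ N.toSubgroup) :=
  Subgroup.mem_iInf

omit [IsTopologicalGroup G] in
instance profinitePCore_normal : (profinitePCore p G).Normal :=
  Subgroup.normal_iInf_normal fun _ => inferInstance

instance isClosed_profinitePCore : IsClosed (profinitePCore p G : Set G) := by
  rw [profinitePCore, Subgroup.coe_iInf]
  refine isClosed_iInter fun N => ?_
  rw [Subgroup.coe_comap]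
  exact (isClosed_discrete _).preimage QuotientGroup.continuous_mk

variable [CompactSpace G] [TotallyDisconnectedSpace G]

theorem isPElement_of_mem_profinitePCore {x : G} (hx : x ∈ profinitePCore p G) :
    IsPElement p x := by
  refine isPElement_iff.2 fun N => ?_
  obtain ⟨k, hk⟩ := isPGroup_pCore ⟨_, mem_profinitePCore.1 hx N⟩
  exact ⟨k, (QuotientGroup.eq_one_iff _).1 (congrArg Subtype.val hk)⟩

theorem le_profinitePCore {B : Subgroup G} [hB : B.Normal] (h : ∀ b ∈ B, IsPElement p b) :
    B ≤ profinitePCore p G := by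
  refine fun b hb => mem_profinitePCore.2 fun N => ?_
  have hBN : (B.map (QuotientGroup.mk' N.toSubgroup)).Normal :=
    hB.map _ (QuotientGroup.mk'_surjective _)
  refine le_pCore (B := B.map (QuotientGroup.mk' N.toSubgroup)) ?_
    (Subgroup.mem_map_of_mem _ hb)
  rintro ⟨_, c, hc, rfl⟩
  exact (isPElement_iff.1 (h c hc) N).imp fun k hk =>
    Subtype.ext ((QuotientGroup.eq_one_iff _).2 hk)

theorem IsPElement.of_quotient_profinitePCore {g : G}
    (hg : IsPElement p (g : G ⧸ profinitePCore p G)) : IsPElement p g := by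
  refine isPElement_iff.2 fun N => ?_
  let π := QuotientGroup.mk' (profinitePCore p G)
  obtain ⟨k, n, hn, hng⟩ := isPElement_iff.1 hg ⟨⟨N.toSubgroup.map π,
    QuotientGroup.isOpenMap_coe _ N.isOpen⟩, N.isNormal'.map _ (QuotientGroup.mk'_surjective _)⟩
  have ha : n⁻¹ * g ^ p ^ k ∈ profinitePCore p G := QuotientGroup.eq.1 hng
  obtain ⟨l, hl⟩ := isPElement_iff.1 (isPElement_of_mem_profinitePCore ha) N
  have hna : ((n⁻¹ * g ^ p ^ k : G) : G ⧸ N.toSubgroup) = (g ^ p ^ k : G) := by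
    rw [QuotientGroup.mk_mul, QuotientGroup.mk_inv, (QuotientGroup.eq_one_iff n).2 hn, inv_one,
      one_mul]
  refine ⟨k + l, (QuotientGroup.eq_one_iff (N := N.toSubgroup) _).1 ?_⟩
  rw [pow_add, pow_mul, QuotientGroup.mk_pow, ← hna, ← QuotientGroup.mk_pow]
  exact (QuotientGroup.eq_one_iff _).2 hl

theorem profinitePCore_quotient : profinitePCore p (G ⧸ profinitePCore p G) = ⊥ := by
  refine eq_bot_iff.2 (QuotientGroup.mk_surjective.forall.2 fun x hx => ?_)
  refine (QuotientGroup.eq_one_iff x).2 (le_profinitePCore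
    (B := (profinitePCore p (G ⧸ profinitePCore p G)).comap (QuotientGroup.mk' _))
    (fun b hb => ?_) hx)
  exact (isPElement_of_mem_profinitePCore hb).of_quotient_profinitePCore

theorem isOpen_centralizer_quotient_profinitePCore [Fact p.Prime] {g : G} (hg : IsPElement p g)
    (hE : ∀ᶠ x in 𝓝 (1 : G), ∃ n, engelCommutator x g n = 1) :
    IsOpen (Subgroup.centralizer {(g : G ⧸ profinitePCore p G)} :
      Set (G ⧸ profinitePCore p G)) := by
  obtain ⟨U, hU, hUo, h1⟩ := mem_nhds_iff.1 hE
  obtain ⟨M, hMU⟩ := ProfiniteGrp.exist_openNormalSubgroup_sub_open_nhds_of_one hUo h1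
  have hM (x : G) (hx : x ∈ M) : engelCommutator x g 1 ∈ profinitePCore p G := by
    refine mem_profinitePCore.2 fun N => ?_
    let π := QuotientGroup.mk' N.toSubgroup
    have : (M.toSubgroup.map π).Normal := M.isNormal'.map _ (QuotientGroup.mk'_surjective _)
    have hgN : ∃ k : ℕ, π g ^ p ^ k = 1 :=
      (isPElement_iff.1 hg N).imp fun k hk => (QuotientGroup.eq_one_iff _).2 hk
    change π _ ∈ _
    rw [map_engelCommutator]
    refine engelCommutator_one_mem_pCore hgN ?_ (Subgroup.mem_map_of_mem π hx)
    rintro _ ⟨y, hy, rfl⟩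
    exact (hU (hMU hy)).imp fun n hn => by rw [← map_engelCommutator, hn, map_one]
  refine Subgroup.isOpen_mono (H₁ := M.toSubgroup.map (QuotientGroup.mk' _)) ?_
    (QuotientGroup.isOpenMap_coe _ M.isOpen)
  rintro _ ⟨x, hx, rfl⟩
  rw [Subgroup.mem_centralizer_singleton_iff, eq_comm]
  refine QuotientGroup.eq.2 ?_
  have := hM x hx
  simpa [engelCommutator, mul_assoc] using this

end ProfinitePCore

section OpenCentralizers

variable {G : Type*} [Group G] [TopologicalSpace G] [IsTopologicalGroup G] [CompactSpace G]
  [TotallyDisconnectedSpace G] {p : ℕ}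

/-- If `y` centralizes `u * v` then `[u, y⁻¹] = v * (y * v⁻¹ * y⁻¹)`, which is near `1` when `v` is,
whereas the commutators of `u` with elements outside the open subgroup `C(u)` stay away from `1`. -/
theorem exists_centralizer_mul_le {u : G} (hu : IsOpen (Subgroup.centralizer {u} : Set G)) :
    ∃ D : OpenNormalSubgroup G, ∀ v ∈ D,
      Subgroup.centralizer {u * v} ≤ Subgroup.centralizer {u} := by
  let F : Set G := (fun y => u⁻¹ * y * u * y⁻¹) '' (Subgroup.centralizer {u} : Set G)ᶜ
  have hF : IsClosed F := (hu.isClosed_compl.isCompact.image (by fun_prop)).isClosed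
  have h1F : (1 : G) ∉ F := by
    rintro ⟨y, hy, hyu⟩
    refine hy (Subgroup.mem_centralizer_singleton_iff.2 ?_)
    rw [mul_inv_eq_one, mul_assoc, inv_mul_eq_iff_eq_mul] at hyu
    exact hyu
  obtain ⟨D, hD⟩ := ProfiniteGrp.exist_openNormalSubgroup_sub_open_nhds_of_one hF.isOpen_compl h1F
  refine ⟨D, fun v hv y hy => by_contra fun hyu => ?_⟩
  refine hD ?_ (Set.mem_image_of_mem _ hyu)
  have hcomm : u⁻¹ * y * u * y⁻¹ = v * (y * v⁻¹ * y⁻¹) := by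
    calc u⁻¹ * y * u * y⁻¹ = u⁻¹ * (y * (u * v)) * v⁻¹ * y⁻¹ := by group
      _ = v * (y * v⁻¹ * y⁻¹) := by
        rw [Subgroup.mem_centralizer_singleton_iff.1 hy]; group
  change u⁻¹ * y * u * y⁻¹ ∈ D
  rw [hcomm]
  exact D.toSubgroup.mul_mem hv (D.isNormal'.conj_mem _ (D.toSubgroup.inv_mem hv) y)

variable (h : ∀ g : G, IsPElement p g → IsOpen (Subgroup.centralizer {g} : Set G))
include h

theorem exists_isPElement_forall_index_centralizer_mul_le :
    ∃ u : G, IsPElement p u ∧ ∃ D : OpenNormalSubgroup G, ∀ v ∈ D, IsPElement p (u * v) →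
      (Subgroup.centralizer {u * v}).index ≤ (Subgroup.centralizer {u}).index := by
  let P : Set G := {g | IsPElement p g}
  have hindex (u) (hu : u ∈ P) : (Subgroup.centralizer {u}).FiniteIndex :=
    have := Subgroup.quotient_finite_of_isOpen _ (h u hu)
    Subgroup.finiteIndex_of_finite_quotient
  have : Nonempty P := ⟨1, isPElement_one⟩
  have : CompactSpace P := isCompact_iff_compactSpace.1 isClosed_setOf_isPElement.isCompact
  obtain ⟨u, hmax⟩ :=
    exists_isLocalMax_of_lowerSemicontinuous (lowerSemicontinuous_index_centralizer hindex)
  obtain ⟨V, hV, hVmax⟩ := mem_nhds_subtype _ _ _ |>.1 hmax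
  obtain ⟨V', hV'V, hV', huV'⟩ := mem_nhds_iff.1 hV
  obtain ⟨D, hD⟩ := ProfiniteGrp.exist_openNormalSubgroup_sub_open_nhds_of_one
    (hV'.preimage (continuous_const_mul (u : G))) (by simpa using huV')
  exact ⟨u, u.2, D, fun v hv huv => hVmax (a := ⟨u * v, huv⟩) (hV'V (hD hv))⟩

theorem exists_forall_isPElement_le_centralizer :
    ∃ D : OpenNormalSubgroup G, ∀ v ∈ D, IsPElement p v →
      D.toSubgroup ≤ Subgroup.centralizer {v} := by
  obtain ⟨u, hu, D₁, hD₁⟩ := exists_isPElement_forall_index_centralizer_mul_le h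
  obtain ⟨D₂, hD₂⟩ := exists_centralizer_mul_le (h u hu)
  obtain ⟨D₃, hD₃⟩ := ProfiniteGrp.exist_openNormalSubgroup_sub_open_nhds_of_one
    (h u hu) (Subgroup.one_mem _)
  refine ⟨D₁ ⊓ D₂ ⊓ D₃, fun v hv hvp d hd => ?_⟩
  have huv : Commute u v := (Subgroup.mem_centralizer_singleton_iff.1 (hD₃ hv.2)).symm
  have huvp : IsPElement p (u * v) := hu.mul hvp huv
  have : Finite (G ⧸ Subgroup.centralizer {u * v}) :=
    Subgroup.quotient_finite_of_isOpen _ (h _ huvp)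
  have : (Subgroup.centralizer {u * v}).FiniteIndex := Subgroup.finiteIndex_of_finite_quotient
  have heq : Subgroup.centralizer {u * v} = Subgroup.centralizer {u} :=
    (hD₂ v hv.1.2).eq_of_not_lt fun hlt =>
      (Subgroup.index_strictAnti hlt).not_ge (hD₁ v hv.1.1 huvp)
  have hdu : Commute d u := Subgroup.mem_centralizer_singleton_iff.1 (hD₃ hd.2)
  have hduv : Commute d (u * v) :=
    Subgroup.mem_centralizer_singleton_iff.1 (heq.ge (hD₃ hd.2))
  rw [Subgroup.mem_centralizer_singleton_iff, ← inv_mul_cancel_left u v]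
  exact hdu.inv_right.mul_right hduv

theorem exists_forall_isPElement_eq_one (hcore : profinitePCore p G = ⊥) :
    ∃ D : OpenNormalSubgroup G, ∀ v ∈ D, IsPElement p v → v = 1 := by
  obtain ⟨D, hD⟩ := exists_forall_isPElement_le_centralizer h
  have hcomm {a b : G} (ha : a ∈ D) (hb : b ∈ D) (hbp : IsPElement p b) : Commute a b :=
    Subgroup.mem_centralizer_singleton_iff.1 (hD b hb hbp ha)
  let B : Subgroup G :=
    { carrier := {v | v ∈ D ∧ IsPElement p v}
      one_mem' := ⟨D.toSubgroup.one_mem, isPElement_one⟩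
      mul_mem' := fun {a b} ha hb =>
        ⟨D.toSubgroup.mul_mem ha.1 hb.1, ha.2.mul hb.2 (hcomm ha.1 hb.1 hb.2)⟩
      inv_mem' := fun {a} ha => ⟨D.toSubgroup.inv_mem ha.1, ha.2.inv⟩ }
  have hB : B.Normal := ⟨fun v hv g => ⟨D.isNormal'.conj_mem v hv.1 g, hv.2.conj g⟩⟩
  have hbot : B ≤ ⊥ := hcore ▸ le_profinitePCore fun b hb => hb.2
  exact ⟨D, fun v hv hvp => Subgroup.mem_bot.1 (hbot ⟨hv, hvp⟩)⟩

theorem finite_setOf_isPElement (hcore : profinitePCore p G = ⊥) :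
    {g : G | IsPElement p g}.Finite := by
  obtain ⟨D, hD⟩ := exists_forall_isPElement_eq_one h hcore
  refine isClosed_setOf_isPElement.isCompact.finite ?_
  refine isDiscrete_iff_forall_mem_exists_isOpen.2 fun u hu => ?_
  refine ⟨(u⁻¹ * ·) ⁻¹' (D ∩ Subgroup.centralizer {u}),
    (D.isOpen.inter (h u hu)).preimage (continuous_const_mul _),
    Set.Subset.antisymm ?_ (Set.singleton_subset_iff.2 ⟨?_, hu⟩)⟩
  · rintro w ⟨⟨hwD, hwC⟩, hw⟩
    have hcomm : Commute u⁻¹ w := by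
      have huw : Commute u (u⁻¹ * w) := (Subgroup.mem_centralizer_singleton_iff.1 hwC).symm
      simpa using ((Commute.refl u).mul_right huw).inv_left
    exact (inv_mul_eq_one.1 (hD _ hwD (IsPElement.mul hu.inv hw hcomm))).symm
  · rw [Set.mem_preimage, inv_mul_cancel]
    exact ⟨D.toSubgroup.one_mem, Subgroup.one_mem _⟩

theorem finite_closure_setOf_isPElement (hcore : profinitePCore p G = ⊥) :
    Finite (Subgroup.closure {g : G | IsPElement p g}) := by
  have hfin := finite_setOf_isPElement h hcore
  refine finite_closure hfin (fun g hg => ?_) fun g hg => ?_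
  · refine finite_powers.1 (hfin.subset ?_)
    rintro _ ⟨n, rfl⟩
    exact IsPElement.pow hg n
  · have := Subgroup.quotient_finite_of_isOpen _ (h g hg)
    exact Subgroup.finiteIndex_of_finite_quotient

end OpenCentralizers

section Main

variable {G : Type*} [Group G] [TopologicalSpace G] [IsTopologicalGroup G] [CompactSpace G]
  [TotallyDisconnectedSpace G] {p : ℕ}

theorem isVirtuallyProP_of_finiteIndex_profinitePCore {N : Subgroup G} (hN : IsClosed (N : Set G))
    (hfin : ((profinitePCore p G).subgroupOf N).FiniteIndex) : IsVirtuallyProP p N := by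
  have : CompactSpace N := isCompact_iff_compactSpace.1 hN.isCompact
  have hclosed : IsClosed ((profinitePCore p G).subgroupOf N : Set N) :=
    isClosed_profinitePCore.preimage continuous_subtype_val
  refine ⟨⟨inferInstance, inferInstance, inferInstance, inferInstance⟩, _,
    Subgroup.isOpen_of_isClosed_of_finiteIndex _ hclosed, (isProP_iff hclosed).2 fun b hb M => ?_⟩
  obtain ⟨L, hL⟩ := exists_openNormalSubgroup_subgroupOf_le M.isOpen
  exact (isPElement_iff.1 (isPElement_of_mem_profinitePCore hb) L).imp fun k hk => hL hk

theorem isVirtuallyProP_comap_mk {N : Subgroup (G ⧸ profinitePCore p G)} [Finite N] :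
    IsVirtuallyProP p (N.comap (QuotientGroup.mk' (profinitePCore p G))) := by
  refine isVirtuallyProP_of_finiteIndex_profinitePCore
    ((N : Set (G ⧸ profinitePCore p G)).toFinite.isClosed.preimage QuotientGroup.continuous_mk) ?_
  refine Subgroup.finiteIndex_of_le
    (H := ((QuotientGroup.mk' (profinitePCore p G)).subgroupComap N).ker) fun x hx => ?_
  exact (QuotientGroup.eq_one_iff (x : G)).1 (congrArg Subtype.val (MonoidHom.mem_ker.1 hx))

theorem IsEngelSink.eventually_engelCommutator_eq_one {g : G} {E : Set G}
    (hE : IsEngelSink g E) (hfin : E.Finite) :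
    ∀ᶠ x in 𝓝 (1 : G), ∃ n, engelCommutator x g n = 1 := by
  obtain ⟨M, hM⟩ := ProfiniteGrp.exist_openNormalSubgroup_sub_open_nhds_of_one
    (hfin.subset (Set.sdiff_subset (t := {1}))).isClosed.isOpen_compl (fun h1 => h1.2 rfl)
  filter_upwards [M.isOpen.mem_nhds M.toSubgroup.one_mem] with x hx
  obtain ⟨n, -, hn⟩ := hE x
  have hxM : engelCommutator x g n ∈ M.toSubgroup := engelCommutator_mem_of_normal hx g n
  exact ⟨n, by_contra fun h1 => hM hxM ⟨hn n le_rfl, h1⟩⟩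

end Main

theorem theorem1p2_general {G : Type*} [Group G] [TopologicalSpace G] [IsTopologicalGroup G]
    [CompactSpace G] [TotallyDisconnectedSpace G] {p : ℕ} (hp : p.Prime)
    (h : ∀ g : G, IsPElement p g → ∀ᶠ x in 𝓝 (1 : G), ∃ n, engelCommutator x g n = 1) :
    ∃ (N : Subgroup G) (_ : N.Normal), IsClosed (N : Set G) ∧
      IsVirtuallyProP p N ∧ IsProPPrime p (G ⧸ N) := by
  have : Fact p.Prime := ⟨hp⟩
  let A := profinitePCore p G
  let N₀ : Subgroup (G ⧸ A) := Subgroup.closure {g | IsPElement p g}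
  have hC : ∀ g : G ⧸ A, IsPElement p g → IsOpen (Subgroup.centralizer {g} : Set (G ⧸ A)) :=
    QuotientGroup.mk_surjective.forall.2 fun g hg =>
      isOpen_centralizer_quotient_profinitePCore hg.of_quotient_profinitePCore
        (h g hg.of_quotient_profinitePCore)
  have : Finite N₀ := finite_closure_setOf_isPElement hC profinitePCore_quotient
  have hclosed : IsClosed (N₀.comap (QuotientGroup.mk' A) : Set G) :=
    (N₀ : Set (G ⧸ A)).toFinite.isClosed.preimage QuotientGroup.continuous_mk
  exact ⟨N₀.comap (QuotientGroup.mk' A), inferInstance, hclosed, isVirtuallyProP_comap_mk,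
    isProPPrime_quotient hp hclosed fun g hg =>
      Subgroup.subset_closure (hg.map (f := QuotientGroup.mk' A) QuotientGroup.continuous_mk)⟩

theorem theorem1p2 {G : Type*} [Group G] [TopologicalSpace G] [IsTopologicalGroup G]
    [CompactSpace G] [T2Space G] [TotallyDisconnectedSpace G] (p : ℕ) (hp : p.Prime)
    (h : ∀ g : G, IsPElement p g → ∃ E : Set G, E.Finite ∧ IsEngelSink g E) :
    ∃ (N : Subgroup G) (_ : N.Normal), IsClosed (N : Set G) ∧
      IsVirtuallyProP p N ∧ IsProPPrime p (G ⧸ N) :=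
  theorem1p2_general hp fun g hg =>
    have ⟨_, hfin, hE⟩ := h g hg
    hE.eventually_engelCommutator_eq_one hfin
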